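/- Let $n>0$ be an odd integer, $d=\lfloor n/2\rfloor$, and let $k\ge 2$ be an integer. Let $G_n$ be the graph whose vertices are the chords of the $n$-cycle (pairs of cycle vertices at cyclic distance at least $2$), two chords $ab$ and $ce$ being adjacent when they overlap, i.e. when $a,c,b,e$ are distinct and occur in this cyclic order, in one of the two directions, around the cycle. For a graph $G$ with $p$ vertices and Laplacian matrix $L$, let $$\mathcal{FJ}_k(G)=\max\Big\{\tfrac{k-1}{2k}\,\mathrm{trace}(LX)\ :\ X\in\mathbb{R}^{p\times p},\ X\succeq 0,\ X_{ii}=1\ (1\le i\le p),\ X\ge \tfrac{-1}{k-1}J\Big\},$$ where $J$ is the all-ones matrix (of the appropriate order), $\succeq 0$ means symmetric positive semidefinite, and $\ge$ is entrywise. Then the maximum defining $\mathcal{FJ}_k(G_n)$ is attained and $$\mathcal{FJ}_k(G_n)=\min\ \ n\sum_{i=2}^d y_i+\frac{n}{k-1}\,\mathrm{trace}\Big(J\Big(X^{(0)}+2\sum_{t=1}^d X^{(t)}\Big)\Big),$$ where the minimum, which is attained, is over all $y=(y_i)_{2\le i\le d}$ with $y_i\in\mathbb{R}$ and all real matrices $X^{(0)},\dots,X^{(d)}$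 with rows and columns indexed by $\{2,\dots,d\}$ such that $X^{(m)}=(X^{(m)})^T\ge 0$ and $$\mathrm{Diag}\Big(y-\tfrac{k-1}{2k}\,val\Big)+\Lambda^{(m)}\succeq 0\qquad\text{for all } 0\le m\le d.$$ Here $val_i=i(i-1)+2(i-1)(d-i)$ for $2\le i\le d$, and $\Lambda^{(m)}$ is the real symmetric matrix given, for $2\le i\le j\le d$, by $$\Lambda^{(m)}_{ij}=\Lambda^{(m)}_{ji}=\frac{k-1}{k}\sum_{t=\ell_{ij}+1}^{\ell_{ij}+i-1}\cos\frac{2\pi mt}{n}-X^{(0)}_{ij}-2\sum_{t=1}^d X^{(t)}_{ij}\cos\frac{2\pi mt}{n},$$ with $\ell_{ij}\in\{0,\dots,n-1\}$ congruent modulo $n$ to $d(i-j)$ if $i$ and $j$ have the same parity, and to $d(i-j)-j$ otherwise. (For $n\in\{1,3\}$ the index set is empty and both sides are $0$.) -/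

import Mathlib

namespace FriezeJerrum

/-- `X` is feasible for the Frieze-Jerrum semidefinite program of order `|V|`: it is symmetric
positive semidefinite, has unit diagonal, and `X ≥ -1/(k-1) J` entrywise. -/
def Feasible {V : Type*} [Fintype V] (k : ℕ) (X : Matrix V V ℝ) : Prop :=
  X.PosSemidef ∧ (∀ i, X i i = 1) ∧ ∀ i j, -1 / ((k : ℝ) - 1) ≤ X i j

open scoped Classical in
/-- The objective values of the Frieze-Jerrum semidefinite program for max-`k`-cut on `G`:
`(k-1)/(2k) * trace (L X)`, where `L` is the Laplacian matrix of `G` and `X` is feasible. -/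
noncomputable def values {V : Type*} [Fintype V] (k : ℕ) (G : SimpleGraph V) : Set ℝ :=
  {v | ∃ X : Matrix V V ℝ, Feasible k X ∧
    v = ((k : ℝ) - 1) / (2 * k) * (G.lapMatrix ℝ * X).trace}

/-- The Frieze-Jerrum bound `FJ_k(G)`. -/
noncomputable def bound {V : Type*} [Fintype V] (k : ℕ) (G : SimpleGraph V) : ℝ :=
  sSup (values k G)

/-- The chords of the cycle with vertices `0, 1, ..., n - 1`: the unordered pairs of distinct
vertices that are not joined by an edge of the cycle. -/
abbrev Chord (n : ℕ) : Type :=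
  {e : Sym2 (Fin n) // e ∈ (SimpleGraph.cycleGraph n)ᶜ.edgeSet}

/-- Two chords overlap if they can be written `ab` and `ce` with `a, c, b, e` in this (strict)
cyclic order. Exchanging the names `c` and `e` amounts to reversing the direction. -/
def Overlap {n : ℕ} (p q : Chord n) : Prop :=
  ∃ a b c e : Fin n, p.1 = s(a, b) ∧ q.1 = s(c, e) ∧ sbtw a c b ∧ sbtw b e a

theorem Overlap.symm {n : ℕ} {p q : Chord n} (h : Overlap p q) : Overlap q p := by
  obtain ⟨a, b, c, e, hp, hq, h1, h2⟩ := h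
  refine ⟨c, e, b, a, hq, by rw [hp, Sym2.eq_swap], ?_, ?_⟩ <;>
  · rw [Fin.sbtw_iff] at *
    omega

theorem Overlap.irrefl {n : ℕ} (p : Chord n) : ¬ Overlap p p := by
  rintro ⟨a, b, c, e, hp, hq, h1, h2⟩
  rw [hp, Sym2.eq_iff] at hq
  rw [Fin.sbtw_iff] at *
  omega

/-- The graph `G_n`: its vertices are the chords of the `n`-cycle, adjacent when they overlap. -/
def chordGraph (n : ℕ) : SimpleGraph (Chord n) where
  Adj := Overlap
  symm := ⟨fun _ _ h => h.symm⟩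
  loopless := ⟨fun p => Overlap.irrefl p⟩

/-- The index set `{2, ..., d}` (with `d - 1` elements when `d ≥ 1`) of the reduced program. -/
abbrev Idx (d : ℕ) : Type := {i : ℕ // i ∈ Finset.Icc 2 d}

/-- `val_i = i (i - 1) + 2 (i - 1) (d - i)`. -/
def val (d : ℕ) (i : Idx d) : ℝ :=
  (i.1 : ℝ) * ((i.1 : ℝ) - 1) + 2 * ((i.1 : ℝ) - 1) * ((d : ℝ) - (i.1 : ℝ))

/-- `ℓ_{ij}` as an element of `{0, ..., n - 1}`, where `d = ⌊n / 2⌋`. -/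
def ell (n i j : ℕ) : ℤ :=
  if i % 2 = j % 2 then (((n / 2 : ℕ) : ℤ) * ((i : ℤ) - j)) % n
  else (((n / 2 : ℕ) : ℤ) * ((i : ℤ) - j) - j) % n

/-- `(k-1)/k * ∑_{t = ℓ_{ij}+1}^{ℓ_{ij}+i-1} cos (2 π m t / n)`, used for `i ≤ j`. -/
noncomputable def edgeTerm (n k m i j : ℕ) : ℝ :=
  ((k : ℝ) - 1) / k *
    ∑ t ∈ Finset.Icc (ell n i j + 1) (ell n i j + i - 1),
      Real.cos (2 * Real.pi * m * t / n)

/-- The real symmetric matrix `Λ^{(m)}`; the edge term is prescribed for `i ≤ j` and extended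
symmetrically to `i > j`. -/
noncomputable def Lam (n k : ℕ) (X : Fin (n / 2 + 1) → Matrix (Idx (n / 2)) (Idx (n / 2)) ℝ)
    (m : ℕ) : Matrix (Idx (n / 2)) (Idx (n / 2)) ℝ :=
  Matrix.of fun i j =>
    edgeTerm n k m (min i.1 j.1) (max i.1 j.1) - X 0 i j
      - 2 * ∑ t : Fin (n / 2), X t.succ i j * Real.cos (2 * Real.pi * m * ((t : ℝ) + 1) / n)

/-- Feasibility in the reduced program: `y` is a real vector indexed by `{2, ..., d}`, the
`X^{(0)}, ..., X^{(d)}` are symmetric and entrywise nonnegative, and the `d + 1` linear matrix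
inequalities hold. -/
def ReducedFeasible (n k : ℕ) (y : Idx (n / 2) → ℝ)
    (X : Fin (n / 2 + 1) → Matrix (Idx (n / 2)) (Idx (n / 2)) ℝ) : Prop :=
  (∀ m, (X m).IsSymm) ∧ (∀ m i j, 0 ≤ X m i j) ∧
  ∀ m : Fin (n / 2 + 1),
    (Matrix.diagonal (fun i => y i - ((k : ℝ) - 1) / (2 * k) * val (n / 2) i)
      + Lam n k X m).PosSemidef

/-- The objective of the reduced program,
`n ∑ y_i + n/(k-1) * trace (J (X^{(0)} + 2 ∑_{t=1}^d X^{(t)}))` with `J` the all-ones matrix. -/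
noncomputable def reducedObjective (n k : ℕ) (y : Idx (n / 2) → ℝ)
    (X : Fin (n / 2 + 1) → Matrix (Idx (n / 2)) (Idx (n / 2)) ℝ) : ℝ :=
  n * ∑ i, y i + n / ((k : ℝ) - 1) *
    ((Matrix.of fun _ _ => (1 : ℝ)) * (X 0 + (2 : ℝ) • ∑ t : Fin (n / 2), X t.succ)).trace

/-- The set of objective values attained by feasible points of the reduced program. -/
def reducedValues (n k : ℕ) : Set ℝ :=
  {v | ∃ y X, ReducedFeasible n k y X ∧ v = reducedObjective n k y X}

end FriezeJerrum

/-! The feasible set is compact and contains the identity, so the maximum is attained. The reduced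
program is the conic dual of the Frieze-Jerrum program after the symmetry of the cycle has been
divided out. Before the reduction, a dual point is a vector `y` and a matrix `Z ≥ 0` with `Diag(y) -
(k-1)/(2k) L - Z ⪰ 0`, of value `∑ y + 1/(k-1) ∑ Z`. Weak duality (`sum_mul_le_of_dual`) pairs this
slack matrix with a feasible `X`. Strong duality with attainment (`exists_dual`) separates a point
from a convex cone whose interior is nonempty because positive diagonal matrices serve as Slater
points. Label a chord by its length `i` in `{2, ..., d}` and its centre in `ZMod n`. Overlap then
depends only on the two lengths and on the difference of the centres up to sign
(`adj_chordEquiv_iff`), so `L` is block-circulant with even blocks. Averaging a dual point over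
rotations and over `c ↦ -c` keeps its feasibility and its value, and makes `y` depend on the length
only and `Z` on lengths and offset only. The discrete cosine transform turns positive
semidefiniteness of such a matrix into that of one block of order `d - 1` for each frequency `m`
(`posSemidef_fourier_block`, `posSemidef_of_fourier_blocks`). The frequencies `m` and `-m` give the
same block, which leaves `0 ≤ m ≤ d`; these blocks are the matrices `Diag(y - (k-1)/(2k) val) +
Λ^{(m)}`. -/

namespace FriezeJerrum

/-! ### Compactness and duality for the Frieze-Jerrum program of an arbitrary finite order. -/

section Semidefinite

variable {V : Type*} [Fintype V]

theorem posSemidef_iff_sum {M : Matrix V V ℝ} :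
    M.PosSemidef ↔ M.IsSymm ∧ ∀ v : V → ℝ, 0 ≤ ∑ i, ∑ j, M i j * (v i * v j) := by
  rw [Matrix.posSemidef_iff_dotProduct_mulVec, Matrix.isHermitian_iff_isSymm]
  refine and_congr_right fun _ => forall_congr' fun v => ?_
  have h : star v ⬝ᵥ M.mulVec v = ∑ i, ∑ j, M i j * (v i * v j) := by
    simp only [dotProduct, Matrix.mulVec, Finset.mul_sum, Pi.star_apply, star_trivial]
    exact Finset.sum_congr rfl fun i _ => Finset.sum_congr rfl fun j _ => by ring
  rw [h]

/-- By the Schur product theorem the Hadamard product is positive semidefinite; its quadratic form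
is evaluated at the all-ones vector. -/
theorem sum_mul_nonneg_of_posSemidef {A B : Matrix V V ℝ} (hA : A.PosSemidef)
    (hB : B.PosSemidef) : 0 ≤ ∑ i, ∑ j, A i j * B i j := by
  simpa [Matrix.hadamard_apply] using (posSemidef_iff_sum.1 (hA.hadamard hB)).2 fun _ => 1

theorem posSemidef_vecMulVec (v : V → ℝ) :
    (Matrix.of fun i j => v i * v j : Matrix V V ℝ).PosSemidef := by
  refine posSemidef_iff_sum.2 ⟨Matrix.IsSymm.ext fun i j => by simp [mul_comm], fun w => ?_⟩
  have h : ∑ i, ∑ j, (Matrix.of fun i j => v i * v j : Matrix V V ℝ) i j * (w i * w j)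
      = (∑ i, v i * w i) ^ 2 := by
    rw [sq, Finset.sum_mul_sum]
    exact Finset.sum_congr rfl fun i _ => Finset.sum_congr rfl fun j _ => by
      simp only [Matrix.of_apply]; ring
  rw [h]
  positivity

/-- Evaluate the quadratic form at `e_i + e_j` and `e_i - e_j`. With unit diagonal this bounds every
entry by 1, which gives compactness. -/
theorem two_mul_abs_le_of_posSemidef {X : Matrix V V ℝ} (hX : X.PosSemidef) (i j : V) :
    2 * |X i j| ≤ X i i + X j j := by
  classical
  obtain ⟨hs, hq⟩ := posSemidef_iff_sum.1 hX
  have key : ∀ s : ℝ, ∑ a, ∑ b, X a b * ((Pi.single i 1 + s • Pi.single j 1 : V → ℝ) a *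
      (Pi.single i 1 + s • Pi.single j 1 : V → ℝ) b)
      = X i i + 2 * s * X i j + s ^ 2 * X j j := by
    intro s
    have h := hs.apply i j
    simp only [Pi.add_apply, Pi.smul_apply, smul_eq_mul, Pi.single_apply, mul_add, add_mul,
      Finset.sum_add_distrib, mul_ite, ite_mul, mul_one, mul_zero, zero_mul, one_mul,
      Finset.sum_ite_eq', Finset.mem_univ, if_true]
    rw [h]
    ring
  have h1 := hq (Pi.single i 1 + (1 : ℝ) • Pi.single j 1)
  have h2 := hq (Pi.single i 1 + (-1 : ℝ) • Pi.single j 1)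
  rw [key] at h1 h2
  rcases abs_cases (X i j) with ⟨h, _⟩ | ⟨h, _⟩ <;> rw [h] <;> linarith

theorem isClosed_posSemidef : IsClosed {X : Matrix V V ℝ | X.PosSemidef} := by
  have h : {X : Matrix V V ℝ | X.PosSemidef} = {X | X.transpose = X} ∩
      ⋂ v : V → ℝ, {X | 0 ≤ ∑ i, ∑ j, X i j * (v i * v j)} := by
    ext X
    simp [posSemidef_iff_sum, Matrix.IsSymm]
  rw [h]
  refine (isClosed_eq (by fun_prop) (by fun_prop)).inter (isClosed_iInter fun v => ?_)
  exact isClosed_le (by fun_prop) (by fun_prop)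

theorem isCompact_feasible (k : ℕ) : IsCompact {X : Matrix V V ℝ | Feasible k X} := by
  have hc : IsClosed {X : Matrix V V ℝ | Feasible k X} := by
    have h : {X : Matrix V V ℝ | Feasible k X} = {X | X.PosSemidef} ∩
        ((⋂ i, {X | X i i = 1}) ∩ ⋂ i, ⋂ j, {X | -1 / ((k : ℝ) - 1) ≤ X i j}) := by
      ext X
      simp [Feasible]
    rw [h]
    refine isClosed_posSemidef.inter ((isClosed_iInter fun i => ?_).inter
      (isClosed_iInter fun i => isClosed_iInter fun j => ?_))
    · exact isClosed_eq (by fun_prop) (by fun_prop)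
    · exact isClosed_le (by fun_prop) (by fun_prop)
  refine IsCompact.of_isClosed_subset (isCompact_Icc (α := V → V → ℝ) (a := fun _ _ => -1)
    (b := fun _ _ => 1)) hc fun X hX => ?_
  have h : ∀ i j, |X i j| ≤ 1 := fun i j => by
    have := two_mul_abs_le_of_posSemidef hX.1 i j
    rw [hX.2.1, hX.2.1] at this
    linarith
  exact ⟨fun i j => (abs_le.1 (h i j)).1, fun i j => (abs_le.1 (h i j)).2⟩

theorem feasible_one [DecidableEq V] {k : ℕ} (hk : 2 ≤ k) :
    Feasible k (1 : Matrix V V ℝ) := by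
  have hk' : (2 : ℝ) ≤ k := by exact_mod_cast hk
  refine ⟨Matrix.PosSemidef.one, fun i => Matrix.one_apply_eq i, fun i j => ?_⟩
  have h : -1 / ((k : ℝ) - 1) ≤ 0 := div_nonpos_of_nonpos_of_nonneg (by norm_num) (by linarith)
  refine h.trans ?_
  rw [Matrix.one_apply]
  split_ifs <;> norm_num

theorem isGreatest_bound {k : ℕ} (hk : 2 ≤ k) (G : SimpleGraph V) :
    IsGreatest (values k G) (bound k G) := by
  classical
  have h : values k G = (fun X : Matrix V V ℝ =>
      ((k : ℝ) - 1) / (2 * k) * (G.lapMatrix ℝ * X).trace) '' {X | Feasible k X} := by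
    ext v
    simp only [values, Set.mem_ofPred_eq, Set.mem_image]
    exact exists_congr fun X => and_congr_right fun _ => eq_comm
  have hc : IsCompact (values k G) := by
    rw [h]
    exact (isCompact_feasible k).image (by fun_prop)
  exact hc.isGreatest_sSup (h ▸ ⟨_, Set.mem_image_of_mem _ (feasible_one hk)⟩)

/-- Weak duality for the Frieze-Jerrum program with objective matrix `C`. -/
theorem sum_mul_le_of_dual [DecidableEq V] {k : ℕ} {C Z X : Matrix V V ℝ}
    {y : V → ℝ} (hZ : ∀ i j, 0 ≤ Z i j) (hM : (Matrix.diagonal y - C - Z).PosSemidef)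
    (hX : Feasible k X) :
    ∑ i, ∑ j, C i j * X i j ≤ ∑ i, y i + 1 / ((k : ℝ) - 1) * ∑ i, ∑ j, Z i j := by
  have h := sum_mul_nonneg_of_posSemidef hM hX.1
  have hd : ∑ i, ∑ j, (Matrix.diagonal y) i j * X i j = ∑ i, y i := by
    simp [Matrix.diagonal_apply, hX.2.1]
  have hz : -(1 / ((k : ℝ) - 1) * ∑ i, ∑ j, Z i j) ≤ ∑ i, ∑ j, Z i j * X i j := by
    rw [Finset.mul_sum, ← Finset.sum_neg_distrib]
    refine Finset.sum_le_sum fun i _ => ?_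
    rw [Finset.mul_sum, ← Finset.sum_neg_distrib]
    refine Finset.sum_le_sum fun j _ => ?_
    have := mul_le_mul_of_nonneg_left (hX.2.2 i j) (hZ i j)
    calc _ = Z i j * (-1 / ((k : ℝ) - 1)) := by ring
      _ ≤ _ := this
  simp only [Matrix.sub_apply, sub_mul, Finset.sum_sub_distrib, hd] at h
  linarith

/-- The cone of triples dominated by (diagonal, entries, objective value) of a positive
semidefinite matrix. -/
def dualityCone (C : Matrix V V ℝ) : Set ((V → ℝ) × (V → V → ℝ) × ℝ) :=
  {p | ∃ X : Matrix V V ℝ, X.PosSemidef ∧ (∀ i, p.1 i = X i i) ∧ (∀ i j, p.2.1 i j ≤ X i j) ∧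
    p.2.2 ≤ ∑ i, ∑ j, C i j * X i j}

theorem dualityCone_smul_mem {C : Matrix V V ℝ} {p : (V → ℝ) × (V → V → ℝ) × ℝ}
    (hp : p ∈ dualityCone C) {a : ℝ} (ha : 0 ≤ a) : a • p ∈ dualityCone C := by
  obtain ⟨X, hX, h1, h2, h3⟩ := hp
  refine ⟨a • X, hX.smul ha, fun i => ?_, fun i j => ?_, ?_⟩
  · simp [h1]
  · simpa using mul_le_mul_of_nonneg_left (h2 i j) ha
  · have := mul_le_mul_of_nonneg_left h3 ha
    simpa [Finset.mul_sum, mul_left_comm] using this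

theorem dualityCone_add_mem {C : Matrix V V ℝ} {p q : (V → ℝ) × (V → V → ℝ) × ℝ}
    (hp : p ∈ dualityCone C) (hq : q ∈ dualityCone C) : p + q ∈ dualityCone C := by
  obtain ⟨X, hX, h1, h2, h3⟩ := hp
  obtain ⟨Y, hY, k1, k2, k3⟩ := hq
  refine ⟨X + Y, hX.add hY, fun i => ?_, fun i j => ?_, ?_⟩
  · simp [h1, k1]
  · simpa using add_le_add (h2 i j) (k2 i j)
  · simpa [mul_add, Finset.sum_add_distrib] using add_le_add h3 k3

theorem convex_dualityCone (C : Matrix V V ℝ) : Convex ℝ (dualityCone C) :=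
  fun _ hp _ hq _ _ ha hb _ =>
    dualityCone_add_mem (dualityCone_smul_mem hp ha) (dualityCone_smul_mem hq hb)

/-- Slater condition: the three strict inequalities define an open set, and each of its points is
witnessed by the diagonal matrix built from its first component. -/
theorem mem_interior_dualityCone (C : Matrix V V ℝ) {p : (V → ℝ) × (V → V → ℝ) × ℝ}
    (h1 : ∀ i, 0 < p.1 i) (h2 : ∀ i j, p.2.1 i j < 0) (h3 : p.2.2 < ∑ i, C i i * p.1 i) :
    p ∈ interior (dualityCone C) := by
  classical
  let U : Set ((V → ℝ) × (V → V → ℝ) × ℝ) := (⋂ i, {p | 0 < p.1 i}) ∩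
    ((⋂ i, ⋂ j, {p | p.2.1 i j < 0}) ∩ {p | p.2.2 < ∑ i, C i i * p.1 i})
  have hU : IsOpen U := by
    refine (isOpen_iInter_of_finite fun i => ?_).inter
      ((isOpen_iInter_of_finite fun i => isOpen_iInter_of_finite fun j => ?_).inter ?_)
    · exact isOpen_lt (by fun_prop) (by fun_prop)
    · exact isOpen_lt (by fun_prop) (by fun_prop)
    · exact isOpen_lt (by fun_prop) (by fun_prop)
  refine mem_interior.2 ⟨U, fun q hq => ?_, hU, by simpa [U] using ⟨h1, h2, h3⟩⟩
  simp only [U, Set.mem_inter_iff, Set.mem_iInter, Set.mem_ofPred_eq] at hq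
  obtain ⟨q1, q2, q3⟩ := hq
  refine ⟨Matrix.diagonal q.1, Matrix.PosSemidef.diagonal fun i => (q1 i).le, fun i => by simp,
    fun i j => (q2 i j).le.trans ?_, ?_⟩
  · rw [Matrix.diagonal_apply]
    split_ifs
    exacts [(q1 i).le, le_rfl]
  · simpa [Matrix.diagonal_apply] using q3.le

/-- Strong duality for the Frieze-Jerrum program, with attainment in the dual. -/
theorem exists_dual [DecidableEq V] {k : ℕ} (hk : 2 ≤ k) {C : Matrix V V ℝ} (hC : C.IsSymm)
    {v : ℝ} (hv : ∀ X, Feasible k X → ∑ i, ∑ j, C i j * X i j ≤ v) :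
    ∃ (y : V → ℝ) (Z : Matrix V V ℝ), Z.IsSymm ∧ (∀ i j, 0 ≤ Z i j) ∧
      (Matrix.diagonal y - C - Z).PosSemidef ∧
      ∑ i, y i + 1 / ((k : ℝ) - 1) * ∑ i, ∑ j, Z i j ≤ v := by
  have hk' : (2 : ℝ) ≤ k := by exact_mod_cast hk
  have hb : -1 / ((k : ℝ) - 1) < 0 := div_neg_of_neg_of_pos (by norm_num) (by linarith)
  set b := -1 / ((k : ℝ) - 1) with hbdef
  let x : (V → ℝ) × (V → V → ℝ) × ℝ := (fun _ => 1, fun _ _ => b, v)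
  -- Otherwise the objective coordinate could be raised slightly above `v` inside the cone,
  -- producing a feasible matrix of value greater than `v`.
  have hx : x ∉ interior (dualityCone C) := by
    intro hx
    have hcont : Filter.Tendsto (fun t : ℝ => ((fun _ => 1, fun _ _ => b, v + t) :
        (V → ℝ) × (V → V → ℝ) × ℝ)) (nhdsWithin 0 (Set.Ioi 0)) (nhds x) := by
      have : Continuous (fun t : ℝ => ((fun _ => 1, fun _ _ => b, v + t) :
        (V → ℝ) × (V → V → ℝ) × ℝ)) := by fun_prop
      have h0 := this.tendsto 0
      simp only [add_zero] at h0
      exact h0.mono_left nhdsWithin_le_nhds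
    have hev := hcont (mem_interior_iff_mem_nhds.1 hx)
    obtain ⟨t, ht, ht0⟩ := (Filter.Eventually.and (Filter.mem_map.1 hev) self_mem_nhdsWithin).exists
    obtain ⟨X, hX, h1, h2, h3⟩ := ht
    have := hv X ⟨hX, fun i => (h1 i).symm, h2⟩
    have ht0' : 0 < t := ht0
    simp only at h3
    linarith
  obtain ⟨f, hf⟩ := geometric_hahn_banach_open_point (convex_dualityCone C).interior
    isOpen_interior hx
  let x₀ : (V → ℝ) × (V → V → ℝ) × ℝ := (fun _ => 1, fun _ _ => b, min v (∑ i, C i i) - 1)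
  have hx₀ : x₀ ∈ interior (dualityCone C) := by
    refine mem_interior_dualityCone C (fun _ => one_pos) (fun _ _ => hb) ?_
    have := min_le_right v (∑ i, C i i)
    simp only [x₀, mul_one]
    linarith
  -- The separation is strict only on the interior; it passes to the whole cone because a convex set
  -- with nonempty interior lies in the closure of that interior.
  have hle : ∀ p ∈ dualityCone C, f p ≤ f x := by
    intro p hp
    have : p ∈ closure (interior (dualityCone C)) := by
      rw [(convex_dualityCone C).closure_interior_eq_closure_of_nonempty_interior ⟨_, hx₀⟩]
      exact subset_closure hp
    exact closure_minimal (fun q hq => (hf q hq).le)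
      (isClosed_le f.continuous continuous_const) this
  have h0mem : (0 : (V → ℝ) × (V → V → ℝ) × ℝ) ∈ dualityCone C :=
    ⟨0, Matrix.PosSemidef.zero, by simp, by simp, by simp⟩
  have hx0 : 0 ≤ f x := by simpa using hle 0 h0mem
  have hneg : ∀ p ∈ dualityCone C, f p ≤ 0 := by
    intro p hp
    by_contra! h
    -- With this scaling `f` takes the value `f x + f p > f x`.
    have := hle _ (dualityCone_smul_mem hp (a := f x / f p + 1) (by positivity))
    rw [map_smul, smul_eq_mul, add_mul, div_mul_cancel₀ _ h.ne'] at this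
    linarith
  let α : V → ℝ := fun i => f (Pi.single i 1, 0, 0)
  let β : V → V → ℝ := fun i j => f (0, Pi.single i (Pi.single j 1), 0)
  let γ : ℝ := f (0, 0, 1)
  have hfeq : ∀ u w r, f (u, w, r) = ∑ i, u i * α i + ∑ i, ∑ j, w i j * β i j + r * γ := by
    intro u w r
    have hd : ((u, w, r) : (V → ℝ) × (V → V → ℝ) × ℝ) = ∑ i, u i • (Pi.single i 1, 0, 0)
        + ∑ i, ∑ j, w i j • (0, Pi.single i (Pi.single j 1), 0) + r • (0, 0, 1) := by
      refine Prod.ext ?_ (Prod.ext ?_ ?_)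
      · ext a
        simp [Prod.fst_sum, Finset.sum_apply, Pi.single_apply]
      · ext a c
        simp [Prod.fst_sum, Prod.snd_sum, Finset.sum_apply, Pi.single_apply]
      · simp [Prod.snd_sum]
    rw [hd]
    simp only [map_add, map_sum, map_smul, smul_eq_mul, α, β, γ]
  -- `x₀` and `x` differ only in the objective coordinate, where `x₀` is smaller, and `f x₀ < f x`.
  -- Positivity of `γ` is what permits normalising by it.
  have hγ : 0 < γ := by
    have h := hf _ hx₀
    simp only [x₀, x, hfeq] at h
    have h' : min v (∑ i, C i i) - 1 < v := by linarith [min_le_left v (∑ i, C i i)]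
    have h'' : 0 < (v - (min v (∑ i, C i i) - 1)) * γ := by linarith
    exact pos_of_mul_pos_right h'' (by linarith)
  have hβ : ∀ i j, 0 ≤ β i j := by
    intro i j
    have hm : ((0, -Pi.single i (Pi.single j 1), 0) : (V → ℝ) × (V → V → ℝ) × ℝ)
        ∈ dualityCone C := by
      refine ⟨0, Matrix.PosSemidef.zero, by simp, fun a c => ?_, by simp⟩
      simp only [Pi.neg_apply, Matrix.zero_apply, Left.neg_nonpos_iff, Pi.single_apply]
      split_ifs <;> simp [Pi.single_apply]
      split_ifs <;> norm_num
    have h := hneg _ hm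
    have e : ((0, -Pi.single i (Pi.single j 1), 0) : (V → ℝ) × (V → V → ℝ) × ℝ)
      = -(0, Pi.single i (Pi.single j 1), 0) := by simp
    rw [e, map_neg] at h
    linarith
  have hγ' := hγ.ne'
  -- The multipliers are the coefficients of `f` scaled by `γ`, with `β` symmetrised. The slack
  -- matrix is positive semidefinite because `f ≤ 0` at the cone points given by the rank-one
  -- matrices `w wᵀ`; the bound on the value is `0 ≤ f x`.
  refine ⟨fun i => -α i / γ, Matrix.of fun i j => (β i j + β j i) / (2 * γ),
    Matrix.IsSymm.ext fun i j => by simp [add_comm], fun i j => ?_, ?_, ?_⟩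
  · have := hβ i j
    have := hβ j i
    simp only [Matrix.of_apply]
    positivity
  · refine posSemidef_iff_sum.2 ⟨?_, fun w => ?_⟩
    · refine ((Matrix.isSymm_diagonal _).sub hC).sub ?_
      exact Matrix.IsSymm.ext fun i j => by simp [add_comm]
    · have h := hneg (fun i => w i * w i, fun i j => w i * w j,
        ∑ i, ∑ j, C i j * (w i * w j)) ⟨_, posSemidef_vecMulVec w, fun _ => rfl,
          fun _ _ => le_rfl, le_rfl⟩
      rw [hfeq] at h
      have hsw : ∑ i, ∑ j, w i * w j * β j i = ∑ i, ∑ j, w i * w j * β i j := by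
        rw [Finset.sum_comm]
        exact Finset.sum_congr rfl fun i _ => Finset.sum_congr rfl fun j _ => by ring
      have e : ∑ i, ∑ j, (Matrix.diagonal (fun i => -α i / γ) - C -
          Matrix.of fun i j => (β i j + β j i) / (2 * γ)) i j * (w i * w j)
          = -(∑ i, w i * w i * α i) / γ - ∑ i, ∑ j, C i j * (w i * w j)
            - (∑ i, ∑ j, w i * w j * β i j) / γ := by
        have e1 : ∑ i, ∑ j, (β i j + β j i) / (2 * γ) * (w i * w j)
            = (∑ i, ∑ j, w i * w j * β i j) / γ := by
          have : (∑ i, ∑ j, w i * w j * β i j) / γ = (∑ i, ∑ j, w i * w j * β i j) / (2 * γ) +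
              (∑ i, ∑ j, w i * w j * β j i) / (2 * γ) := by
            rw [hsw]; field_simp; ring
          rw [this]
          simp only [Finset.sum_div, ← Finset.sum_add_distrib]
          exact Finset.sum_congr rfl fun i _ => Finset.sum_congr rfl fun j _ => by ring
        have e2 : ∑ i, ∑ j, Matrix.diagonal (fun i => -α i / γ) i j * (w i * w j)
            = -(∑ i, w i * w i * α i) / γ := by
          simp only [Matrix.diagonal_apply, ite_mul, zero_mul, Finset.sum_ite_eq,
            Finset.mem_univ, if_true, ← Finset.sum_neg_distrib, Finset.sum_div]
          exact Finset.sum_congr rfl fun i _ => by ring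
        simp only [Matrix.sub_apply, sub_mul, Finset.sum_sub_distrib, e2, Matrix.of_apply, e1]
      rw [e]
      have : -(∑ i, w i * w i * α i) / γ - ∑ i, ∑ j, C i j * (w i * w j)
            - (∑ i, ∑ j, w i * w j * β i j) / γ = -(∑ i, w i * w i * α i +
              ∑ i, ∑ j, w i * w j * β i j + (∑ i, ∑ j, C i j * (w i * w j)) * γ) / γ := by
        field_simp; ring
      rw [this]
      exact div_nonneg (by linarith) hγ.le
  · simp only [x, hfeq, one_mul] at hx0
    have hsw : ∑ i, ∑ j, β j i = ∑ i, ∑ j, β i j := Finset.sum_comm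
    have e : ∑ i, -α i / γ + 1 / ((k : ℝ) - 1) * ∑ i, ∑ j,
        (Matrix.of fun i j => (β i j + β j i) / (2 * γ)) i j
        = (-(∑ i, α i) - ∑ i, ∑ j, b * β i j) / γ := by
      simp only [Matrix.of_apply, ← Finset.sum_div, Finset.sum_add_distrib, hsw,
        Finset.sum_neg_distrib, ← Finset.mul_sum, hbdef]
      field_simp
      ring
    rw [e, div_le_iff₀ hγ]
    linarith

end Semidefinite

end FriezeJerrum

namespace FriezeJerrum

/-! ### Cosine transform on `ZMod n` and block-circulant positive semidefinite matrices. -/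

section Fourier

variable {n : ℕ} [NeZero n]

/-- The function `x ↦ cos (2 π x / n)` on `ZMod n`. -/
noncomputable def cosZ (x : ZMod n) : ℝ := (ZMod.stdAddChar x).re

/-- The function `x ↦ sin (2 π x / n)` on `ZMod n`. -/
noncomputable def sinZ (x : ZMod n) : ℝ := (ZMod.stdAddChar x).im

theorem cosZ_intCast (j : ℤ) : cosZ (j : ZMod n) = Real.cos (2 * Real.pi * j / n) := by
  have h : (2 * Real.pi * Complex.I * j / n : ℂ) = ((2 * Real.pi * j / n : ℝ) : ℂ) * Complex.I := by
    push_cast; ring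
  rw [cosZ, ZMod.stdAddChar_coe, h, Complex.exp_ofReal_mul_I_re]

theorem cosZ_natCast_mul_intCast (m : ℕ) (t : ℤ) :
    cosZ ((m : ZMod n) * (t : ZMod n)) = Real.cos (2 * Real.pi * m * t / n) := by
  have := cosZ_intCast (n := n) (m * t)
  push_cast at this
  rw [this, ← mul_assoc]

@[simp] theorem cosZ_zero : cosZ (0 : ZMod n) = 1 := by simp [cosZ]

@[simp] theorem cosZ_neg (x : ZMod n) : cosZ (-x) = cosZ x := by
  simp [cosZ, AddChar.map_neg_eq_conj]

theorem cosZ_sub (x y : ZMod n) : cosZ (x - y) = cosZ x * cosZ y + sinZ x * sinZ y := by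
  simp [cosZ, sinZ, sub_eq_add_neg, AddChar.map_add_eq_mul, AddChar.map_neg_eq_conj]

theorem cosZ_add (x y : ZMod n) : cosZ (x + y) = cosZ x * cosZ y - sinZ x * sinZ y := by
  simp [cosZ, sinZ, AddChar.map_add_eq_mul]

theorem sum_cosZ_mul (b : ZMod n) : ∑ m : ZMod n, cosZ (m * b) = if b = 0 then (n : ℝ) else 0 := by
  have h := congrArg Complex.re
    (AddChar.sum_mulShift b (ZMod.isPrimitive_stdAddChar n))
  rw [Complex.re_sum] at h
  simp only [cosZ, h, ZMod.card]
  split_ifs <;> simp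

theorem sum_cosZ_mul_cosZ (b c : ZMod n) :
    ∑ m : ZMod n, cosZ (m * b) * cosZ (m * c)
      = ((if c = b then (n : ℝ) else 0) + if c = -b then (n : ℝ) else 0) / 2 := by
  have h : ∀ m : ZMod n, cosZ (m * b) * cosZ (m * c)
      = (cosZ (m * (c - b)) + cosZ (m * (c + b))) / 2 := fun m => by
    rw [mul_sub, mul_add, cosZ_sub, cosZ_add]; ring
  simp only [h, ← Finset.sum_div, Finset.sum_add_distrib, sum_cosZ_mul, sub_eq_zero,
    add_eq_zero_iff_eq_neg]

/-- Fourier inversion for even functions on `ZMod n`. -/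
theorem eq_sum_cosZ {f : ZMod n → ℝ} (hf : ∀ c, f (-c) = f c) (x : ZMod n) :
    n * f x = ∑ m : ZMod n, (∑ c, f c * cosZ (m * c)) * cosZ (m * x) := by
  simp only [Finset.sum_mul]
  rw [Finset.sum_comm]
  -- Orthogonality of cosines keeps only `c = x` and `c = -x`, each with weight `n / 2`; evenness
  -- merges the two terms.
  have h : ∀ c : ZMod n, ∑ m : ZMod n, f c * cosZ (m * c) * cosZ (m * x)
      = f c * (((if x = c then (n : ℝ) else 0) + if x = -c then (n : ℝ) else 0) / 2) := fun c => by
    simp only [← sum_cosZ_mul_cosZ, Finset.mul_sum, mul_assoc]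
  simp only [h, mul_div_assoc', mul_add, ← Finset.sum_div, Finset.sum_add_distrib]
  have h2 : ∑ c, f c * (if x = -c then (n : ℝ) else 0) = f (-x) * n := by
    rw [Finset.sum_eq_single (-x)] <;> simp +contextual [eq_neg_iff_add_eq_zero, add_comm]
  rw [h2, hf]
  simp
  ring

variable {I : Type*} [Fintype I]

/-- A cosine of a difference is a sum of two rank-one kernels, so each term on the right is a
quadratic form whose sign can be controlled separately. -/
theorem sum_mul_cosZ_sub (W : I × ZMod n → I × ZMod n → ℝ) (m : ZMod n) :
    ∑ p, ∑ q, W p q * cosZ (m * (q.2 - p.2)) =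
      ∑ p, ∑ q, W p q * (cosZ (m * p.2) * cosZ (m * q.2)) +
      ∑ p, ∑ q, W p q * (sinZ (m * p.2) * sinZ (m * q.2)) := by
  simp only [← Finset.sum_add_distrib]
  refine Finset.sum_congr rfl fun p _ => Finset.sum_congr rfl fun q _ => ?_
  rw [mul_sub, cosZ_sub]
  ring

/-- The Fourier blocks of the average of a positive semidefinite matrix over the cyclic shifts
are positive semidefinite. -/
theorem posSemidef_fourier_block {M : Matrix (I × ZMod n) (I × ZMod n) ℝ} (hM : M.PosSemidef)
    (m : ZMod n) :
    (Matrix.of fun i j => ∑ c, (∑ a, M (i, a) (j, a + c)) * cosZ (m * c)).PosSemidef := by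
  obtain ⟨hs, hq⟩ := posSemidef_iff_sum.1 hM
  have hblock : ∀ i j, ∑ c, (∑ a, M (i, a) (j, a + c)) * cosZ (m * c)
      = ∑ a, ∑ b, M (i, a) (j, b) * cosZ (m * (b - a)) := fun i j => by
    simp only [Finset.sum_mul]
    rw [Finset.sum_comm]
    refine Finset.sum_congr rfl fun a _ => ?_
    exact Fintype.sum_equiv (Equiv.addLeft a) _ _ fun c => by simp
  simp only [hblock]
  refine posSemidef_iff_sum.2 ⟨Matrix.IsSymm.ext fun i j => ?_, fun v => ?_⟩
  · simp only [Matrix.of_apply]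
    rw [Finset.sum_comm]
    refine Finset.sum_congr rfl fun a _ => Finset.sum_congr rfl fun b _ => ?_
    rw [hs.apply, ← neg_sub a b, mul_neg, cosZ_neg]
  · have h1 := hq fun p => v p.1 * cosZ (m * p.2)
    have h2 := hq fun p => v p.1 * sinZ (m * p.2)
    have e : ∑ i, ∑ j, (Matrix.of fun i j => ∑ a, ∑ b, M (i, a) (j, b) * cosZ (m * (b - a))) i j
        * (v i * v j) = ∑ p, ∑ q, (M p q * (v p.1 * v q.1)) * cosZ (m * (q.2 - p.2)) := by
      simp only [Fintype.sum_prod_type, Matrix.of_apply, Finset.sum_mul]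
      refine Finset.sum_congr rfl fun i _ => ?_
      rw [Finset.sum_comm]
      refine Finset.sum_congr rfl fun a _ => Finset.sum_congr rfl fun j _ =>
        Finset.sum_congr rfl fun b _ => by ring
    rw [e, sum_mul_cosZ_sub]
    refine add_nonneg (h1.trans_eq ?_) (h2.trans_eq ?_) <;>
      exact Finset.sum_congr rfl fun p _ => Finset.sum_congr rfl fun q _ => by ring

/-- A block-circulant matrix with even blocks is positive semidefinite as soon as its Fourier
blocks are. -/
theorem posSemidef_of_fourier_blocks {f : I → I → ZMod n → ℝ} (hf : ∀ i j c, f i j (-c) = f i j c)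
    (h : ∀ m : ZMod n, (Matrix.of fun i j => ∑ c, f i j c * cosZ (m * c)).PosSemidef) :
    (Matrix.of fun p q : I × ZMod n => f p.1 q.1 (q.2 - p.2)).PosSemidef := by
  have hn : (0 : ℝ) < n := by exact_mod_cast Nat.pos_of_ne_zero (NeZero.ne n)
  have hinv : ∀ i j x, f i j x
      = (∑ m : ZMod n, (∑ c, f i j c * cosZ (m * c)) * cosZ (m * x)) / n := fun i j x => by
    rw [← eq_sum_cosZ (hf i j), mul_div_cancel_left₀ _ hn.ne']
  refine posSemidef_iff_sum.2 ⟨Matrix.IsSymm.ext fun p q => ?_, fun w => ?_⟩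
  · simp only [Matrix.of_apply]
    -- Symmetry of `f` in its two indices is not assumed; it is recovered by Fourier inversion from
    -- the symmetry of the blocks.
    rw [← neg_sub, hf, hinv, hinv]
    congr 1
    exact Finset.sum_congr rfl fun m _ => congrArg (· * _)
      (by simpa using (posSemidef_iff_sum.1 (h m)).1.apply p.1 q.1)
  · have e : ∑ p, ∑ q, (Matrix.of fun p q : I × ZMod n => f p.1 q.1 (q.2 - p.2)) p q * (w p * w q)
        = (∑ m : ZMod n, ∑ p : I × ZMod n, ∑ q : I × ZMod n,
          ((∑ c, f p.1 q.1 c * cosZ (m * c)) * (w p * w q)) * cosZ (m * (q.2 - p.2))) / n := by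
      symm
      rw [Finset.sum_comm, Finset.sum_div]
      refine Finset.sum_congr rfl fun p _ => ?_
      rw [Finset.sum_comm, Finset.sum_div]
      refine Finset.sum_congr rfl fun q _ => ?_
      rw [Matrix.of_apply, hinv, div_mul_eq_mul_div, Finset.sum_mul]
      congr 1
      exact Finset.sum_congr rfl fun m _ => by ring
    rw [e]
    refine div_nonneg (Finset.sum_nonneg fun m _ => ?_) hn.le
    obtain ⟨hs, hq⟩ := posSemidef_iff_sum.1 (h m)
    rw [sum_mul_cosZ_sub]
    -- The sum over both shifts collapses to the quadratic form of the block of frequency `m` at the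
    -- vector `i ↦ ∑ a, w (i, a) * g a`.
    have key : ∀ g : ZMod n → ℝ, 0 ≤ ∑ p : I × ZMod n, ∑ q : I × ZMod n,
        ((∑ c, f p.1 q.1 c * cosZ (m * c)) * (w p * w q)) * (g p.2 * g q.2) := fun g => by
      refine (hq fun i => ∑ a, w (i, a) * g a).trans_eq ?_
      simp only [Fintype.sum_prod_type, Matrix.of_apply]
      refine Finset.sum_congr rfl fun i _ => ?_
      rw [Finset.sum_comm]
      refine Finset.sum_congr rfl fun j _ => ?_
      rw [Finset.sum_mul_sum, Finset.mul_sum]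
      refine Finset.sum_congr rfl fun a _ => ?_
      rw [Finset.mul_sum]
      exact Finset.sum_congr rfl fun b _ => by ring
    exact add_nonneg (key fun a => cosZ (m * a)) (key fun a => sinZ (m * a))

end Fourier

/-- Summation over `ZMod n`, `n` odd, by pairing `c` with `-c`. -/
theorem sum_zmod_of_odd {n : ℕ} [NeZero n] (hn : Odd n) (f : ZMod n → ℝ) :
    ∑ c, f c = f 0 + ∑ t : Fin (n / 2), (f ((t : ℕ) + 1 : ℕ) + f (-((t : ℕ) + 1 : ℕ))) := by
  obtain ⟨d, rfl⟩ := hn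
  have hd : (2 * d + 1) / 2 = d := by omega
  have h1 : ∑ c, f c = ∑ t ∈ Finset.range (2 * d + 1), f (t : ZMod (2 * d + 1)) := by
    rw [Finset.sum_range]
    exact Finset.sum_congr rfl fun t _ => congrArg f (ZMod.natCast_zmod_val (n := 2 * d + 1) t).symm
  have h2 : ∀ t ∈ Finset.range d, f (-((t + 1 : ℕ) : ZMod (2 * d + 1)))
      = f ((2 * d - t : ℕ) : ZMod (2 * d + 1)) := fun t ht => by
    have ht' := Finset.mem_range.1 ht
    congr 1
    rw [neg_eq_iff_add_eq_zero, ← Nat.cast_add, ← ZMod.natCast_self]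
    congr 1
    omega
  have h3 : ∀ g : ℕ → ℝ, ∑ t ∈ Finset.range (2 * d), g t
      = ∑ t ∈ Finset.range d, g t + ∑ t ∈ Finset.range d, g (2 * d - 1 - t) := fun g => by
    have e : Finset.range (2 * d) = Finset.range (d + d) := by rw [two_mul]
    rw [e, Finset.sum_range_add, ← Finset.sum_range_reflect (fun t => g (d + t))]
    congr 1
    refine Finset.sum_congr rfl fun t ht => congrArg g ?_
    have := Finset.mem_range.1 ht
    omega
  have h4 : ∀ g : ℕ → ℝ, ∑ t : Fin ((2 * d + 1) / 2), g t = ∑ t ∈ Finset.range d, g t :=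
    fun g => by rw [Fin.sum_univ_eq_sum_range, hd]
  rw [h4 fun t => f ((t + 1 : ℕ)) + f (-((t + 1 : ℕ))), h1, Finset.sum_range_succ', add_comm,
    h3 fun t => f ((t + 1 : ℕ)), Finset.sum_add_distrib, Finset.sum_congr rfl h2, Nat.cast_zero]
  congr 2
  refine Finset.sum_congr rfl fun t ht => congrArg f (congrArg _ ?_)
  have := Finset.mem_range.1 ht
  omega

end FriezeJerrum

namespace FriezeJerrum

/-! ### Length-centre coordinates on chords, the overlap relation and the degrees of `G_n`. -/

section Chords

variable {n : ℕ}

/-- The offsets between the centres of two overlapping chords of lengths `i ≤ j`. -/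
def IsOffset (n i j : ℕ) (c : ZMod n) : Prop :=
  ∃ t ∈ Finset.Icc 1 (i - 1), c = ((n / 2 : ℕ) : ZMod n) * ((i : ZMod n) - j) + (t : ZMod n) ∨
    c = -(((n / 2 : ℕ) : ZMod n) * ((i : ZMod n) - j) + (t : ZMod n))

theorem isOffset_neg {i j : ℕ} {c : ZMod n} : IsOffset n i j (-c) ↔ IsOffset n i j c := by
  refine exists_congr fun t => and_congr_right fun _ => ?_
  rw [neg_eq_iff_eq_neg, neg_inj, or_comm]

/-- Everything follows from `2 * (n / 2) = -1` in `ZMod n`. Reversing `t ↦ i - t` exchanges the two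
signs in `IsOffset`, and also the two cases in `ell`. -/
theorem offset_reflect (hn : Odd n) {i j t : ℕ} (ht : t ≤ i) :
    ((n / 2 : ℕ) : ZMod n) * ((i : ZMod n) - j) - j + ((i - t : ℕ) : ZMod n)
      = -(((n / 2 : ℕ) : ZMod n) * ((i : ZMod n) - j) + (t : ZMod n)) := by
  have h : (2 : ZMod n) * ((n / 2 : ℕ) : ZMod n) + 1 = 0 := by
    obtain ⟨d, hd⟩ := hn
    have h' : ((2 * (n / 2) + 1 : ℕ) : ZMod n) = 0 := by
      rw [show 2 * (n / 2) + 1 = n by omega, ZMod.natCast_self]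
    exact_mod_cast h'
  rw [Nat.cast_sub ht]
  linear_combination ((i : ZMod n) - j) * h

open scoped Classical in
/-- The indicator of the offsets between overlapping chords of lengths `i` and `j`. -/
noncomputable def offsetInd (n i j : ℕ) (c : ZMod n) : ℝ :=
  if IsOffset n (min i j) (max i j) c then 1 else 0

theorem offsetInd_neg (i j : ℕ) (c : ZMod n) : offsetInd n i j (-c) = offsetInd n i j c := by
  classical exact if_congr isOffset_neg rfl rfl

variable [NeZero n]

/-- The vertex of the `n`-cycle with a given residue. -/
def vert (a : ZMod n) : Fin n := ⟨a.val, a.val_lt⟩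

theorem vert_injective : Function.Injective (vert : ZMod n → Fin n) := fun _ _ h =>
  ZMod.val_injective n (Fin.mk.inj_iff.1 h)

theorem vert_natCast (x : Fin n) : vert ((x : ℕ) : ZMod n) = x :=
  Fin.ext (ZMod.val_cast_of_lt x.2)

theorem val_sub_eq (x y : ZMod n) :
    (y - x).val = if x.val ≤ y.val then y.val - x.val else n + y.val - x.val := by
  have hx := x.val_lt
  have hy := y.val_lt
  have h : y - x = ((if x.val ≤ y.val then y.val - x.val else n + y.val - x.val : ℕ) : ZMod n) := by
    split_ifs with hxy
    · rw [Nat.cast_sub hxy]; simp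
    · rw [Nat.cast_sub (by omega)]; simp
  rw [h, ZMod.val_cast_of_lt]
  split_ifs <;> omega

theorem val_vert_sub_vert (x y : ZMod n) : ((vert x - vert y : Fin n) : ℕ) = (x - y).val := by
  have hx := x.val_lt
  have hy := y.val_lt
  rw [val_sub_eq, Fin.sub_def]
  simp only [vert]
  split_ifs with h
  · rw [show n - y.val + x.val = x.val - y.val + n by omega, Nat.add_mod_right,
      Nat.mod_eq_of_lt (by omega)]
  · rw [Nat.mod_eq_of_lt (by omega)]
    omega

/-- Rotating `x` to `0` turns the cyclic order into the order of residues. -/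
theorem sbtw_vert_iff (x y z : ZMod n) :
    sbtw (vert x) (vert y) (vert z) ↔ 0 < (y - x).val ∧ (y - x).val < (z - x).val := by
  have hx := x.val_lt
  have hy := y.val_lt
  have hz := z.val_lt
  rw [Fin.sbtw_iff, val_sub_eq, val_sub_eq]
  simp only [vert, Fin.mk_lt_mk]
  split_ifs <;> omega

theorem idx_bounds (hn : Odd n) (i : Idx (n / 2)) : 2 ≤ i.1 ∧ 2 * i.1 + 1 ≤ n := by
  have := Finset.mem_Icc.1 i.2
  obtain ⟨d, rfl⟩ := hn
  omega

/-- The chord from the vertex `a` to the vertex `a + i`. -/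
def chordFrom (hn : Odd n) (i : Idx (n / 2)) (a : ZMod n) : Chord n :=
  ⟨s(vert a, vert (a + (i.1 : ZMod n))), by
    have hi := idx_bounds hn i
    have hv : (i.1 : ZMod n).val = i.1 := ZMod.val_cast_of_lt (by omega)
    have hv' : (-(i.1 : ZMod n)).val = n - i.1 := by
      rw [← zero_sub, val_sub_eq, hv]
      simp
      omega
    rw [SimpleGraph.mem_edgeSet, SimpleGraph.compl_adj, SimpleGraph.cycleGraph_adj',
      val_vert_sub_vert, val_vert_sub_vert, add_sub_cancel_left, hv, sub_add_cancel_left, hv']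
    refine ⟨fun h => ?_, by omega⟩
    have h' := vert_injective h
    rw [left_eq_add] at h'
    rw [h', ZMod.val_zero] at hv
    omega⟩

theorem chordFrom_injective (hn : Odd n) {i j : Idx (n / 2)} {a b : ZMod n}
    (h : chordFrom hn i a = chordFrom hn j b) : i = j ∧ a = b := by
  have hi := idx_bounds hn i
  have hj := idx_bounds hn j
  have hvi : (i.1 : ZMod n).val = i.1 := ZMod.val_cast_of_lt (by omega)
  have hvj : (j.1 : ZMod n).val = j.1 := ZMod.val_cast_of_lt (by omega)
  have h' := congrArg Subtype.val h
  simp only [chordFrom, Sym2.eq_iff] at h'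
  rcases h' with ⟨h1, h2⟩ | ⟨h1, h2⟩
  · have h1 := vert_injective h1
    have h2 := vert_injective h2
    rw [h1, add_right_inj] at h2
    exact ⟨Subtype.ext (by rw [← hvi, h2, hvj]), h1⟩
  -- Matching the chords with ends exchanged would force `i + j = 0` in `ZMod n`, impossible because
  -- `0 < i + j < n`.
  · have h1 := vert_injective h1
    have h2 := vert_injective h2
    rw [h1, add_assoc, add_eq_left, ← Nat.cast_add] at h2
    have h3 : ((j.1 + i.1 : ℕ) : ZMod n).val = j.1 + i.1 := ZMod.val_cast_of_lt (by omega)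
    rw [h2, ZMod.val_zero] at h3
    omega

theorem exists_chordFrom (hn : Odd n) (p : Chord n) : ∃ i a, chordFrom hn i a = p := by
  obtain ⟨p, hp⟩ := p
  induction p using Sym2.ind with
  | _ x y =>
    obtain ⟨a, rfl⟩ : ∃ a : ZMod n, vert a = x := ⟨_, vert_natCast x⟩
    obtain ⟨b, rfl⟩ : ∃ b : ZMod n, vert b = y := ⟨_, vert_natCast y⟩
    rw [SimpleGraph.mem_edgeSet, SimpleGraph.compl_adj, SimpleGraph.cycleGraph_adj',
      val_vert_sub_vert, val_vert_sub_vert] at hp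
    have hne : a.val ≠ b.val := fun h => hp.1 (congrArg vert (ZMod.val_injective n h))
    have h2 := hp.2
    have ha := a.val_lt
    have hb := b.val_lt
    have hab := val_sub_eq a b
    have hba := val_sub_eq b a
    obtain ⟨d, hd⟩ := hn
    have hd2 : n / 2 = d := by omega
    -- The two arcs have total length `n`, which is odd, so exactly one has length at most `n / 2`;
    -- the chord starts where that arc starts.
    by_cases h : (b - a).val ≤ n / 2
    · refine ⟨⟨(b - a).val, Finset.mem_Icc.2 ⟨?_, h⟩⟩, a, Subtype.ext ?_⟩
      · split_ifs at hab hba <;> omega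
      · simp [chordFrom]
    · refine ⟨⟨(a - b).val, Finset.mem_Icc.2 ⟨?_, ?_⟩⟩, b, Subtype.ext ?_⟩
      · split_ifs at hab hba <;> omega
      · split_ifs at hab hba <;> omega
      · simp [chordFrom, Sym2.eq_swap]

/-- Chords are labelled by their length and their centre. -/
noncomputable def chordEquiv (hn : Odd n) : Idx (n / 2) × ZMod n ≃ Chord n :=
  -- In `ZMod n` the residue of `n / 2` is `-1/2`, so the starting vertex is the centre minus half
  -- the length.
  Equiv.ofBijective (fun p => chordFrom hn p.1 (p.2 + (n / 2 : ℕ) * p.1.1)) <| by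
    refine ⟨fun p q h => ?_, fun c => ?_⟩
    · obtain ⟨h1, h2⟩ := chordFrom_injective hn h
      rw [h1, add_left_inj] at h2
      exact Prod.ext h1 h2
    · obtain ⟨i, a, h⟩ := exists_chordFrom hn c
      exact ⟨(i, a - (n / 2 : ℕ) * i.1), by simpa using h⟩

theorem chordEquiv_apply (hn : Odd n) (i : Idx (n / 2)) (a : ZMod n) :
    chordEquiv hn (i, a) = chordFrom hn i (a + (n / 2 : ℕ) * i.1) := rfl

/-- Since `i ≤ j` and `i + j < n`, as soon as one end of the longer chord lies strictly inside the
short arc of the other, its second end lies strictly outside. -/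
theorem overlap_chordFrom_iff (hn : Odd n) {i j : Idx (n / 2)} (hij : i.1 ≤ j.1) (a b : ZMod n) :
    Overlap (chordFrom hn i a) (chordFrom hn j b) ↔
      (0 < (b - a).val ∧ (b - a).val < i.1) ∨
        (0 < (b - a + (j.1 : ZMod n)).val ∧ (b - a + (j.1 : ZMod n)).val < i.1) := by
  have hi := idx_bounds hn i
  have hj := idx_bounds hn j
  have hvi : (i.1 : ZMod n).val = i.1 := ZMod.val_cast_of_lt (by omega)
  have hvj : (j.1 : ZMod n).val = j.1 := ZMod.val_cast_of_lt (by omega)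
  have key : ∀ z w : ZMod n, (sbtw (vert a) (vert z) (vert (a + (i.1 : ZMod n))) ∧
      sbtw (vert (a + (i.1 : ZMod n))) (vert w) (vert a)) ↔
      (0 < (z - a).val ∧ (z - a).val < i.1) ∧ i.1 < (w - a).val := fun z w => by
    rw [sbtw_cyclic (a := vert (a + (i.1 : ZMod n))), sbtw_vert_iff, sbtw_vert_iff, add_sub_cancel_left, hvi]
    refine and_congr_right fun _ => ⟨fun h => h.2, fun h => ⟨by omega, h⟩⟩
  have hov : Overlap (chordFrom hn i a) (chordFrom hn j b) ↔
      ((0 < (b - a).val ∧ (b - a).val < i.1) ∧ i.1 < (b + (j.1 : ZMod n) - a).val) ∨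
      ((0 < (b + (j.1 : ZMod n) - a).val ∧ (b + (j.1 : ZMod n) - a).val < i.1) ∧
        i.1 < (b - a).val) := by
    rw [← key, ← key]
    constructor
    · rintro ⟨x, y, z, w, hp, hq, h1, h2⟩
      simp only [chordFrom, Sym2.eq_iff] at hp hq
      rcases hp with ⟨rfl, rfl⟩ | ⟨rfl, rfl⟩ <;> rcases hq with ⟨rfl, rfl⟩ | ⟨rfl, rfl⟩
      · exact Or.inl ⟨h1, h2⟩
      · exact Or.inr ⟨h1, h2⟩
      · exact Or.inr ⟨h2, h1⟩
      · exact Or.inl ⟨h2, h1⟩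
    · rintro (⟨h1, h2⟩ | ⟨h1, h2⟩)
      · exact ⟨_, _, _, _, rfl, rfl, h1, h2⟩
      · exact ⟨_, _, _, _, rfl, Sym2.eq_swap, h1, h2⟩
  rw [hov, add_sub_right_comm]
  have h : (b - a + (j.1 : ZMod n)).val
      = if (b - a).val + j.1 < n then (b - a).val + j.1 else (b - a).val + j.1 - n := by
    have hlt := (b - a).val_lt
    split_ifs with hc
    · rw [ZMod.val_add_of_lt (by rwa [hvj]), hvj]
    · have := ZMod.val_add_val_of_le (a := b - a) (b := (j.1 : ZMod n)) (by rw [hvj]; omega)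
      omega
  have hlt := (b - a).val_lt
  split_ifs at h <;> omega

theorem overlap_chordEquiv_iff_of_le (hn : Odd n) {i j : Idx (n / 2)} (hij : i.1 ≤ j.1)
    (a b : ZMod n) :
    Overlap (chordEquiv hn (i, a)) (chordEquiv hn (j, b)) ↔ IsOffset n i.1 j.1 (b - a) := by
  have hi := idx_bounds hn i
  have hval : ∀ x : ZMod n, (0 < x.val ∧ x.val < i.1) ↔
      ∃ t ∈ Finset.Icc 1 (i.1 - 1), x = (t : ZMod n) := fun x => by
    constructor
    · rintro ⟨h1, h2⟩
      exact ⟨x.val, Finset.mem_Icc.2 ⟨h1, by omega⟩, by simp⟩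
    · rintro ⟨t, ht, rfl⟩
      rw [Finset.mem_Icc] at ht
      rw [ZMod.val_cast_of_lt (by omega)]
      omega
  rw [chordEquiv_apply, chordEquiv_apply, overlap_chordFrom_iff hn hij, hval, hval]
  have hsub : b + ((n / 2 : ℕ) : ZMod n) * j.1 - (a + ((n / 2 : ℕ) : ZMod n) * i.1)
      = b - a - ((n / 2 : ℕ) : ZMod n) * ((i.1 : ZMod n) - j.1) := by ring
  rw [hsub]
  constructor
  · rintro (⟨t, ht, h⟩ | ⟨t, ht, h⟩)
    · exact ⟨t, ht, Or.inl (by rw [← h]; ring)⟩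
    · rw [Finset.mem_Icc] at ht
      refine ⟨i.1 - t, Finset.mem_Icc.2 (by omega), Or.inr ?_⟩
      rw [← offset_reflect hn (Nat.sub_le _ _), Nat.sub_sub_self (by omega), ← h]
      ring
  · rintro ⟨t, ht, h | h⟩
    · exact Or.inl ⟨t, ht, by rw [h]; ring⟩
    · rw [Finset.mem_Icc] at ht
      refine Or.inr ⟨i.1 - t, Finset.mem_Icc.2 (by omega), ?_⟩
      rw [h, ← offset_reflect hn (by omega)]
      ring

theorem adj_chordEquiv_iff (hn : Odd n) (p q : Idx (n / 2) × ZMod n) :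
    (chordGraph n).Adj (chordEquiv hn p) (chordEquiv hn q) ↔
      IsOffset n (min p.1.1 q.1.1) (max p.1.1 q.1.1) (q.2 - p.2) := by
  change Overlap _ _ ↔ _
  rcases le_total p.1.1 q.1.1 with h | h
  · rw [min_eq_left h, max_eq_right h]
    exact overlap_chordEquiv_iff_of_le hn h p.2 q.2
  · rw [min_eq_right h, max_eq_left h, ← neg_sub, isOffset_neg,
      ← overlap_chordEquiv_iff_of_le hn h q.2 p.2]
    exact ⟨Overlap.symm, Overlap.symm⟩

theorem sum_offsetInd_mul (hn : Odd n) (i j : Idx (n / 2)) {g : ZMod n → ℝ}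
    (hg : ∀ c, g (-c) = g c) :
    ∑ c, offsetInd n i.1 j.1 c * g c = 2 * ∑ t ∈ Finset.Icc 1 (min i.1 j.1 - 1),
      g (((n / 2 : ℕ) : ZMod n) * (((min i.1 j.1 : ℕ) : ZMod n) - (max i.1 j.1 : ℕ))
        + (t : ZMod n)) := by
  classical
  have hi := idx_bounds hn i
  have hj := idx_bounds hn j
  have hmin : 2 ≤ min i.1 j.1 := le_min hi.1 hj.1
  have hmm : min i.1 j.1 ≤ max i.1 j.1 := min_le_max
  have hmax : 2 * max i.1 j.1 + 1 ≤ n := by omega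
  simp only [offsetInd]
  generalize min i.1 j.1 = a at *
  generalize max i.1 j.1 = b at *
  set o : ZMod n := ((n / 2 : ℕ) : ZMod n) * ((a : ZMod n) - b) with ho
  let S := (Finset.Icc 1 (a - 1)).image fun t : ℕ => o + (t : ZMod n)
  let T := (Finset.Icc 1 (a - 1)).image fun t : ℕ => -(o + (t : ZMod n))
  have hmem : ∀ c, IsOffset n a b c ↔ c ∈ S ∪ T := fun c => by
    simp only [IsOffset, S, T, Finset.mem_union, Finset.mem_image, ← ho, eq_comm (a := c)]
    constructor
    · rintro ⟨t, ht, h | h⟩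
      exacts [Or.inl ⟨t, ht, h⟩, Or.inr ⟨t, ht, h⟩]
    · rintro (⟨t, ht, h⟩ | ⟨t, ht, h⟩)
      exacts [⟨t, ht, Or.inl h⟩, ⟨t, ht, Or.inr h⟩]
  have hinj : ∀ s ∈ Finset.Icc 1 (a - 1), ∀ t ∈ Finset.Icc 1 (a - 1),
      (s : ZMod n) = t → s = t := fun s hs t ht h => by
    rw [Finset.mem_Icc] at hs ht
    rw [← ZMod.val_cast_of_lt (show s < n by omega), h, ZMod.val_cast_of_lt (by omega)]
  -- A common element would give `b - (a - t) + s = 0` in `ZMod n`, while this integer lies strictly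
  -- between `0` and `n`. Hence each offset is counted once, and the two signs give the factor 2.
  have hdisj : Disjoint S T := by
    rw [Finset.disjoint_left]
    rintro c hc hc'
    obtain ⟨s, hs, rfl⟩ := Finset.mem_image.1 hc
    obtain ⟨t, ht, h⟩ := Finset.mem_image.1 hc'
    rw [Finset.mem_Icc] at hs ht
    rw [ho, ← offset_reflect hn (show t ≤ a by omega)] at h
    have h0 : ((b - (a - t) + s : ℕ) : ZMod n) = 0 := by
      rw [Nat.cast_add, Nat.cast_sub (by omega)]
      linear_combination -h
    have h1 := ZMod.val_cast_of_lt (show b - (a - t) + s < n by omega)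
    rw [h0, ZMod.val_zero] at h1
    omega
  simp only [hmem, ite_mul, one_mul, zero_mul, Finset.sum_ite_mem, Finset.univ_inter]
  rw [Finset.sum_union hdisj, Finset.sum_image, Finset.sum_image, two_mul]
  · simp only [hg]
  · exact fun s hs t ht h => hinj s hs t ht (add_left_cancel (neg_injective h))
  · exact fun s hs t ht h => hinj s hs t ht (add_left_cancel h)

/-- The two signs of each offset contribute equally, which turns `(k-1)/(2k)` into the `(k-1)/k` of
`edgeTerm`. -/
theorem sum_offsetInd_mul_cosZ (hn : Odd n) (k m : ℕ) (i j : Idx (n / 2)) :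
    ((k : ℝ) - 1) / (2 * k) * ∑ c, offsetInd n i.1 j.1 c * cosZ ((m : ZMod n) * c)
      = edgeTerm n k m (min i.1 j.1) (max i.1 j.1) := by
  have hi := idx_bounds hn i
  have hj := idx_bounds hn j
  have hmin : 2 ≤ min i.1 j.1 := le_min hi.1 hj.1
  rw [sum_offsetInd_mul hn i j (fun c => by rw [mul_neg, cosZ_neg]), edgeTerm]
  generalize min i.1 j.1 = a at *
  generalize max i.1 j.1 = b at *
  have hsum : ∑ t ∈ Finset.Icc (ell n a b + 1) (ell n a b + a - 1),
      Real.cos (2 * Real.pi * m * t / n) =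
      ∑ t ∈ Finset.Icc 1 (a - 1), cosZ ((m : ZMod n) * (((ell n a b : ℤ) : ZMod n) + (t : ZMod n))) := by
    symm
    refine Finset.sum_bij' (fun t _ => ell n a b + (t : ℤ)) (fun t _ => (t - ell n a b).toNat)
      ?_ ?_ ?_ ?_ ?_
    · intro t ht
      rw [Finset.mem_Icc] at ht ⊢
      omega
    · intro t ht
      rw [Finset.mem_Icc] at ht ⊢
      omega
    · intro t ht
      omega
    · intro t ht
      rw [Finset.mem_Icc] at ht
      omega
    · intro t ht
      rw [← cosZ_natCast_mul_intCast]
      push_cast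
      rfl
  have hcast : ∀ x : ℤ, ((x % (n : ℤ) : ℤ) : ZMod n) = (x : ZMod n) := fun x =>
    ZMod.intCast_mod x n
  have hmain : ∑ t ∈ Finset.Icc 1 (a - 1), cosZ ((m : ZMod n) * (((ell n a b : ℤ) : ZMod n) + (t : ZMod n)))
      = ∑ t ∈ Finset.Icc 1 (a - 1), cosZ ((m : ZMod n) *
        (((n / 2 : ℕ) : ZMod n) * ((a : ZMod n) - (b : ZMod n)) + (t : ZMod n))) := by
    rw [ell]
    split_ifs with hpar
    · simp only [hcast, Int.cast_mul, Int.cast_sub, Int.cast_natCast]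
    · rw [hcast]
      -- For different parities the range in `ell` is the negative of the standard one, traversed
      -- backwards; the cosine does not see the sign.
      refine Finset.sum_bij' (fun t _ => a - t) (fun t _ => a - t) ?_ ?_ ?_ ?_ ?_
      · intro t ht
        rw [Finset.mem_Icc] at ht ⊢
        omega
      · intro t ht
        rw [Finset.mem_Icc] at ht ⊢
        omega
      · intro t ht
        rw [Finset.mem_Icc] at ht
        omega
      · intro t ht
        rw [Finset.mem_Icc] at ht
        omega
      · intro t ht
        rw [Finset.mem_Icc] at ht
        have h := offset_reflect (j := b) hn (Nat.sub_le a t)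
        rw [Nat.sub_sub_self (by omega)] at h
        simp only [Int.cast_mul, Int.cast_sub, Int.cast_natCast]
        rw [h, mul_neg, cosZ_neg]
  rw [hsum, hmain]
  ring

theorem sum_two_mul_min_sub_one {i d : ℕ} (h2 : 2 ≤ i) (hid : i ≤ d) :
    ∑ j ∈ Finset.Icc 2 d, 2 * ((min i j : ℕ) - 1 : ℝ)
      = (i : ℝ) * (i - 1) + 2 * (i - 1) * (d - i) := by
  induction d, hid using Nat.le_induction with
  | base =>
    have h : ∀ j ∈ Finset.Icc 2 i, 2 * ((min i j : ℕ) - 1 : ℝ) = 2 * ((j : ℝ) - 1) := fun j hj => by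
      rw [min_eq_right (Finset.mem_Icc.1 hj).2]
    rw [Finset.sum_congr rfl h, sub_self, mul_zero, add_zero]
    clear h
    induction i, h2 using Nat.le_induction with
    | base => norm_num
    | succ i hi ih =>
      rw [Finset.sum_Icc_succ_top (by omega), ih]
      push_cast
      ring
  | succ d hd ih =>
    rw [Finset.sum_Icc_succ_top (by omega), ih, min_eq_left (by omega)]
    push_cast
    ring

/-- A chord of length `i` overlaps `2 (min i j - 1)` chords of length `j`; summed over `j` this
makes `val` the vertex degree. -/
theorem sum_offsetInd (hn : Odd n) (i : Idx (n / 2)) :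
    ∑ j : Idx (n / 2), ∑ c, offsetInd n i.1 j.1 c = val (n / 2) i := by
  have hi := Finset.mem_Icc.1 i.2
  have h : ∀ j : Idx (n / 2), ∑ c, offsetInd n i.1 j.1 c = 2 * ((min i.1 j.1 : ℕ) - 1 : ℝ) :=
    fun j => by
      have hmin : 2 ≤ min i.1 j.1 := le_min hi.1 (Finset.mem_Icc.1 j.2).1
      have := sum_offsetInd_mul hn i j (g := fun _ => 1) fun _ => rfl
      simp only [mul_one, Finset.sum_const, Nat.card_Icc, nsmul_eq_mul] at this
      rw [this, Nat.add_sub_cancel, Nat.cast_sub (by omega), Nat.cast_one]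
  rw [Finset.sum_congr rfl fun j _ => h j, val, ← sum_two_mul_min_sub_one hi.1 hi.2]
  exact Finset.sum_coe_sort (Finset.Icc 2 (n / 2)) fun j => 2 * ((min i.1 j : ℕ) - 1 : ℝ)

end Chords

end FriezeJerrum

namespace FriezeJerrum

/-! ### Passage between the dual program on chords and the reduced program. -/

section Reduction

variable {n : ℕ} [NeZero n]

/-- The block-circulant form of the slack matrix of the dual program. -/
noncomputable def slackBlock (n k : ℕ) (y : Idx (n / 2) → ℝ)
    (f : Idx (n / 2) → Idx (n / 2) → ZMod n → ℝ) (i j : Idx (n / 2)) (c : ZMod n) : ℝ :=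
  (if i = j ∧ c = 0 then y i - ((k : ℝ) - 1) / (2 * k) * val (n / 2) i else 0)
    + ((k : ℝ) - 1) / (2 * k) * offsetInd n i.1 j.1 c - f i j c

theorem sum_slackBlock_mul_cosZ (k : ℕ) (y : Idx (n / 2) → ℝ)
    (f : Idx (n / 2) → Idx (n / 2) → ZMod n → ℝ) (i j : Idx (n / 2)) (m : ZMod n) :
    ∑ c, slackBlock n k y f i j c * cosZ (m * c)
      = (if i = j then y i - ((k : ℝ) - 1) / (2 * k) * val (n / 2) i else 0)
        + ((k : ℝ) - 1) / (2 * k) * ∑ c, offsetInd n i.1 j.1 c * cosZ (m * c)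
        - ∑ c, f i j c * cosZ (m * c) := by
  have h : ∑ c : ZMod n, (if i = j ∧ c = 0 then y i - ((k : ℝ) - 1) / (2 * k) * val (n / 2) i
      else 0) * cosZ (m * c)
      = if i = j then y i - ((k : ℝ) - 1) / (2 * k) * val (n / 2) i else 0 := by
    rw [Finset.sum_eq_single 0]
    · simp
    · intro c _ hc
      simp [hc]
    · simp
  simp only [slackBlock, sub_mul, add_mul, Finset.sum_sub_distrib, Finset.sum_add_distrib, h,
    Finset.mul_sum, mul_assoc]

theorem sum_even_of_odd (hn : Odd n) {g : ZMod n → ℝ} (hg : ∀ c, g (-c) = g c) :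
    ∑ c, g c = g 0 + 2 * ∑ t : Fin (n / 2), g ((t : ℕ) + 1 : ℕ) := by
  rw [sum_zmod_of_odd hn, Finset.mul_sum]
  congr 1
  exact Finset.sum_congr rfl fun t _ => by rw [hg]; ring

theorem reduced_block_eq (hn : Odd n) (k : ℕ) (y : Idx (n / 2) → ℝ)
    {X : Fin (n / 2 + 1) → Matrix (Idx (n / 2)) (Idx (n / 2)) ℝ}
    {f : Idx (n / 2) → Idx (n / 2) → ZMod n → ℝ} (hf : ∀ i j c, f i j (-c) = f i j c)
    (hX : ∀ t i j, X t i j = f i j ((t : ℕ) : ZMod n)) (m : ℕ) :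
    Matrix.diagonal (fun i => y i - ((k : ℝ) - 1) / (2 * k) * val (n / 2) i) + Lam n k X m
      = Matrix.of fun i j => ∑ c, slackBlock n k y f i j c * cosZ ((m : ZMod n) * c) := by
  ext i j
  have hsum : ∑ c, f i j c * cosZ ((m : ZMod n) * c) = X 0 i j + 2 * ∑ t : Fin (n / 2),
      X t.succ i j * Real.cos (2 * Real.pi * m * ((t : ℝ) + 1) / n) := by
    rw [sum_even_of_odd hn fun c => by rw [hf, mul_neg, cosZ_neg], hX]
    congr 1
    · simp
    · refine congrArg _ (Finset.sum_congr rfl fun t _ => ?_)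
      have := cosZ_natCast_mul_intCast (n := n) m ((t : ℕ) + 1 : ℕ)
      rw [hX, Fin.val_succ, ← Int.cast_natCast (R := ZMod n), this]
      push_cast
      rfl
  rw [Matrix.of_apply, sum_slackBlock_mul_cosZ, sum_offsetInd_mul_cosZ hn, hsum,
    Matrix.add_apply, Matrix.diagonal_apply, Lam, Matrix.of_apply]
  ring

theorem reducedObjective_eq (hn : Odd n) (k : ℕ) (y : Idx (n / 2) → ℝ)
    {X : Fin (n / 2 + 1) → Matrix (Idx (n / 2)) (Idx (n / 2)) ℝ}
    {f : Idx (n / 2) → Idx (n / 2) → ZMod n → ℝ} (hf : ∀ i j c, f i j (-c) = f i j c)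
    (hX : ∀ t i j, X t i j = f i j ((t : ℕ) : ZMod n)) :
    reducedObjective n k y X
      = n * ∑ i, y i + 1 / ((k : ℝ) - 1) * (n * ∑ i, ∑ j, ∑ c, f i j c) := by
  have h : ((Matrix.of fun _ _ => (1 : ℝ)) * (X 0 + (2 : ℝ) • ∑ t : Fin (n / 2), X t.succ)).trace
      = ∑ i, ∑ j, ∑ c, f i j c := by
    rw [Finset.sum_comm]
    simp only [Matrix.trace, Matrix.diag_apply, Matrix.mul_apply, Matrix.of_apply, one_mul]
    refine Finset.sum_congr rfl fun j _ => Finset.sum_congr rfl fun i _ => ?_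
    rw [sum_even_of_odd hn (hf i j)]
    simp [Matrix.sum_apply, hX]
  rw [reducedObjective, h]
  ring

/-- The block depends on `m` only up to sign, and every residue is, up to sign, one of `0, ..., n /
2`. -/
theorem posSemidef_slackBlock_iff (hn : Odd n) (k : ℕ) (y : Idx (n / 2) → ℝ)
    {X : Fin (n / 2 + 1) → Matrix (Idx (n / 2)) (Idx (n / 2)) ℝ}
    {f : Idx (n / 2) → Idx (n / 2) → ZMod n → ℝ} (hf : ∀ i j c, f i j (-c) = f i j c)
    (hX : ∀ t i j, X t i j = f i j ((t : ℕ) : ZMod n)) :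
    (∀ m : Fin (n / 2 + 1), (Matrix.diagonal
      (fun i => y i - ((k : ℝ) - 1) / (2 * k) * val (n / 2) i) + Lam n k X m).PosSemidef) ↔
    ∀ m : ZMod n,
      (Matrix.of fun i j => ∑ c, slackBlock n k y f i j c * cosZ (m * c)).PosSemidef := by
  constructor
  · intro h m
    have h' := h ⟨m.valMinAbs.natAbs, Nat.lt_succ_of_le (ZMod.natAbs_valMinAbs_le m)⟩
    rw [reduced_block_eq hn k y hf hX] at h'
    simp only [ZMod.natCast_natAbs_valMinAbs] at h'
    split_ifs at h' with hm
    · exact h'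
    · simpa only [neg_mul, cosZ_neg] using h'
  · intro h m
    rw [reduced_block_eq hn k y hf hX]
    exact h _

theorem lapMatrix_chordEquiv [DecidableEq (Chord n)] [DecidableRel (chordGraph n).Adj] (hn : Odd n) (p q : Idx (n / 2) × ZMod n) :
    (chordGraph n).lapMatrix ℝ (chordEquiv hn p) (chordEquiv hn q)
      = (if p = q then val (n / 2) p.1 else 0) - offsetInd n p.1.1 q.1.1 (q.2 - p.2) := by
  have hadj : ∀ q : Idx (n / 2) × ZMod n,
      (if (chordGraph n).Adj (chordEquiv hn p) (chordEquiv hn q) then (1 : ℝ) else 0)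
      = offsetInd n p.1.1 q.1.1 (q.2 - p.2) := fun q => by
    classical exact if_congr (adj_chordEquiv_iff hn p q) rfl rfl
  have hdeg : ((chordGraph n).degree (chordEquiv hn p) : ℝ) = val (n / 2) p.1 := by
    rw [SimpleGraph.degree_eq_sum_if_adj, ← (chordEquiv hn).sum_comp, ← sum_offsetInd hn]
    simp only [hadj, Fintype.sum_prod_type]
    refine Finset.sum_congr rfl fun j _ => ?_
    exact (Equiv.subRight p.2).sum_comp fun c => offsetInd n p.1.1 j.1 c
  rw [SimpleGraph.lapMatrix, Matrix.sub_apply, SimpleGraph.adjMatrix_apply, hadj,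
    SimpleGraph.degMatrix, Matrix.diagonal_apply]
  simp only [(chordEquiv hn).injective.eq_iff, hdeg]

theorem slackBlock_eq [DecidableEq (Chord n)] [DecidableRel (chordGraph n).Adj] (hn : Odd n) (k : ℕ) (y : Idx (n / 2) → ℝ)
    (f : Idx (n / 2) → Idx (n / 2) → ZMod n → ℝ) (p q : Idx (n / 2) × ZMod n) :
    slackBlock n k y f p.1 q.1 (q.2 - p.2) = (if p = q then y p.1 else 0)
      - ((k : ℝ) - 1) / (2 * k) * (chordGraph n).lapMatrix ℝ (chordEquiv hn p) (chordEquiv hn q)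
      - f p.1 q.1 (q.2 - p.2) := by
  have h : p = q ↔ p.1 = q.1 ∧ q.2 - p.2 = 0 := by
    rw [Prod.ext_iff, sub_eq_zero, eq_comm (a := q.2)]
  rw [slackBlock, lapMatrix_chordEquiv]
  simp only [h]
  split_ifs <;> ring

theorem mul_trace_eq_sum {V : Type*} [Fintype V] {L X : Matrix V V ℝ} (hX : X.IsSymm) (a : ℝ) :
    a * (L * X).trace = ∑ i, ∑ j, (a • L) i j * X i j := by
  simp only [Matrix.trace, Matrix.diag_apply, Matrix.mul_apply, Finset.mul_sum, Matrix.smul_apply,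
    smul_eq_mul, mul_assoc]
  exact Finset.sum_congr rfl fun i _ => Finset.sum_congr rfl fun j _ => by rw [hX.apply]

theorem sum_sum_sub {I : Type*} [Fintype I] (f : I → I → ZMod n → ℝ) :
    ∑ p : I × ZMod n, ∑ q : I × ZMod n, f p.1 q.1 (q.2 - p.2)
      = n * ∑ i, ∑ j, ∑ c, f i j c := by
  simp only [Fintype.sum_prod_type]
  have h : ∀ i j a, ∑ b, f i j (b - a) = ∑ c, f i j c := fun i j a =>
    (Equiv.subRight a).sum_comp _
  simp only [h, Finset.sum_const, Finset.card_univ, ZMod.card, nsmul_eq_mul, Finset.mul_sum]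

/-- A reduced point unfolds to a dual point on chords of the same value, to which weak duality
applies. -/
theorem values_le_reducedValues (hn : Odd n) {k : ℕ} {v w : ℝ} (hv : v ∈ values k (chordGraph n))
    (hw : w ∈ reducedValues n k) : v ≤ w := by
  classical
  obtain ⟨Xp, hXp, rfl⟩ := hv
  obtain ⟨y, X, ⟨-, hX0, hpsd⟩, rfl⟩ := hw
  -- The matrices `X^{(0)}, ..., X^{(d)}` are the values on `0, ..., d` of an even function on `ZMod
  -- n`.
  let f : Idx (n / 2) → Idx (n / 2) → ZMod n → ℝ := fun i j c =>
    X ⟨c.valMinAbs.natAbs, Nat.lt_succ_of_le (ZMod.natAbs_valMinAbs_le c)⟩ i j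
  have hf : ∀ i j c, f i j (-c) = f i j c := fun i j c => by
    simp only [f, ZMod.natAbs_valMinAbs_neg]
  have hX : ∀ t i j, X t i j = f i j ((t : ℕ) : ZMod n) := fun t i j => by
    simp only [f, ZMod.valMinAbs_natCast_of_le_half (Nat.le_of_lt_succ t.2), Int.natAbs_natCast]
  have hs : ∀ i j c, slackBlock n k y f i j (-c) = slackBlock n k y f i j c := fun i j c => by
    simp only [slackBlock, hf, offsetInd_neg, neg_eq_zero]
  have hM := (posSemidef_of_fourier_blocks hs
    ((posSemidef_slackBlock_iff hn k y hf hX).1 hpsd)).submatrix (chordEquiv hn).symm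
  let y' : Chord n → ℝ := fun u => y ((chordEquiv hn).symm u).1
  let Z : Matrix (Chord n) (Chord n) ℝ := Matrix.of fun u v =>
    f ((chordEquiv hn).symm u).1 ((chordEquiv hn).symm v).1
      (((chordEquiv hn).symm v).2 - ((chordEquiv hn).symm u).2)
  have hM' : (Matrix.diagonal y' - (((k : ℝ) - 1) / (2 * k)) • (chordGraph n).lapMatrix ℝ
      - Z).PosSemidef := by
    convert hM using 1
    ext u v
    rw [Matrix.submatrix_apply, Matrix.of_apply, slackBlock_eq hn]
    simp [Matrix.diagonal_apply, y', Z]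
  rw [mul_trace_eq_sum (posSemidef_iff_sum.1 hXp.1).1, reducedObjective_eq hn k y hf hX]
  refine le_trans (le_of_eq (by congr!)) ((sum_mul_le_of_dual (fun u v => hX0 _ _ _) hM'
    hXp).trans_eq ?_)
  congr 1
  · rw [← (chordEquiv hn).sum_comp, Fintype.sum_prod_type]
    simp [y', Finset.mul_sum]
  · rw [← sum_sum_sub, ← (chordEquiv hn).sum_comp]
    have h : ∀ u, ∑ v, Z u v = ∑ q, Z u (chordEquiv hn q) := fun u =>
      ((chordEquiv hn).sum_comp fun v => Z u v).symm
    refine congrArg _ (Finset.sum_congr rfl fun p _ => (h (chordEquiv hn p)).trans ?_)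
    simp [Z]

/-- An optimal dual point on chords, averaged over the symmetries of the cycle, is a reduced point
of the same value. -/
theorem exists_mem_reducedValues_le_bound (hn : Odd n) {k : ℕ} (hk : 2 ≤ k) :
    ∃ w ∈ reducedValues n k, w ≤ bound k (chordGraph n) := by
  classical
  have hn0 : (n : ℝ) ≠ 0 := by exact_mod_cast NeZero.ne n
  set e := chordEquiv hn with he
  have hL : ((((k : ℝ) - 1) / (2 * k)) • (chordGraph n).lapMatrix ℝ).IsSymm :=
    ((chordGraph n).isSymm_lapMatrix ℝ).smul _
  obtain ⟨y, Z, hZs, hZ0, hM, hle⟩ := exists_dual hk hL (v := bound k (chordGraph n))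
    fun X hX => by
      rw [← mul_trace_eq_sum (posSemidef_iff_sum.1 hX.1).1]
      refine (isGreatest_bound hk (chordGraph n)).2 ⟨X, hX, ?_⟩
      congr!
  let y' : Idx (n / 2) → ℝ := fun i => (∑ a, y (e (i, a))) / n
  let z : Idx (n / 2) → Idx (n / 2) → ZMod n → ℝ := fun i j c =>
    (∑ a, Z (e (i, a)) (e (j, a + c))) / n
  -- `z` averages `Z` over rotations and `f` is its even part. As `z i j c = z j i (-c)`, taking the
  -- even part also makes each matrix symmetric in `i`, `j`, and sums against even functions such as
  -- cosines are unchanged.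
  let f : Idx (n / 2) → Idx (n / 2) → ZMod n → ℝ := fun i j c => (z i j c + z i j (-c)) / 2
  have hzs : ∀ i j c, z i j c = z j i (-c) := fun i j c => by
    simp only [z]
    congr 1
    refine Fintype.sum_equiv (Equiv.addRight c) _ _ fun a => ?_
    rw [Equiv.coe_addRight, add_neg_cancel_right, hZs.apply]
  have hz0 : ∀ i j c, 0 ≤ z i j c := fun i j c =>
    div_nonneg (Finset.sum_nonneg fun a _ => hZ0 _ _) (Nat.cast_nonneg n)
  have hf : ∀ i j c, f i j (-c) = f i j c := fun i j c => by
    simp only [f, neg_neg]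
    rw [add_comm]
  have hfz : ∀ i j (g : ZMod n → ℝ), (∀ c, g (-c) = g c) →
      ∑ c, f i j c * g c = ∑ c, z i j c * g c := fun i j g hg => by
    have h : ∑ c, z i j (-c) * g c = ∑ c, z i j c * g c :=
      Fintype.sum_equiv (Equiv.neg _) _ _ fun c => by simp [hg]
    simp only [f, div_mul_eq_mul_div, add_mul, ← Finset.sum_div, Finset.sum_add_distrib, h]
    ring
  let X : Fin (n / 2 + 1) → Matrix (Idx (n / 2)) (Idx (n / 2)) ℝ := fun t =>
    Matrix.of fun i j => f i j ((t : ℕ) : ZMod n)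
  have hX : ∀ t i j, X t i j = f i j ((t : ℕ) : ZMod n) := fun _ _ _ => rfl
  refine ⟨_, ⟨y', X, ⟨fun t => Matrix.IsSymm.ext fun i j => ?_, fun t i j => ?_, ?_⟩, rfl⟩, ?_⟩
  · rw [hX, hX]
    simp only [f]
    rw [hzs j i, hzs j i, neg_neg, add_comm]
  · have := hz0 i j ((t : ℕ) : ZMod n)
    have := hz0 i j (-((t : ℕ) : ZMod n))
    rw [hX]
    positivity
  · refine (posSemidef_slackBlock_iff hn k y' hf hX).2 fun m => ?_
    -- Summing the slack matrix over rotations gives `n` times the averaged slack, hence the factor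
    -- `1 / n`.
    have hB := (posSemidef_fourier_block (hM.submatrix e) m).smul
      (inv_nonneg.2 (Nat.cast_nonneg (α := ℝ) n))
    convert hB using 1
    ext i j
    have hb : ∀ c : ZMod n, (∑ a, ((Matrix.diagonal y - (((k : ℝ) - 1) / (2 * k)) •
        (chordGraph n).lapMatrix ℝ - Z).submatrix e e) (i, a) (j, a + c))
        = n * slackBlock n k y' z i j c := fun c => by
      have hterm : ∀ a : ZMod n, ((Matrix.diagonal y - (((k : ℝ) - 1) / (2 * k)) •
          (chordGraph n).lapMatrix ℝ - Z).submatrix e e) (i, a) (j, a + c)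
          = (if i = j ∧ c = 0 then y (e (i, a)) - ((k : ℝ) - 1) / (2 * k) * val (n / 2) i else 0)
            + ((k : ℝ) - 1) / (2 * k) * offsetInd n i.1 j.1 c - Z (e (i, a)) (e (j, a + c)) := by
        intro a
        have hpq : (i, a) = (j, a + c) ↔ i = j ∧ c = 0 := by simp [Prod.ext_iff]
        rw [Matrix.submatrix_apply, Matrix.sub_apply, Matrix.sub_apply, Matrix.smul_apply,
          he, lapMatrix_chordEquiv hn, Matrix.diagonal_apply]
        simp only [(chordEquiv hn).injective.eq_iff, add_sub_cancel_left, hpq, smul_eq_mul]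
        split_ifs <;> ring
      simp only [hterm, slackBlock, Finset.sum_sub_distrib, Finset.sum_add_distrib]
      simp only [mul_sub, mul_add, z, mul_div_cancel₀ _ hn0, Finset.sum_const, Finset.card_univ,
        ZMod.card, nsmul_eq_mul]
      congr 2
      split_ifs
      · simp only [Finset.sum_sub_distrib, Finset.sum_const, Finset.card_univ, ZMod.card,
          nsmul_eq_mul, y', mul_sub, mul_div_cancel₀ _ hn0]
      · simp
    rw [Matrix.smul_apply, Matrix.of_apply, Matrix.of_apply]
    simp only [hb, mul_assoc, ← Finset.mul_sum, smul_eq_mul]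
    rw [inv_mul_cancel_left₀ hn0, sum_slackBlock_mul_cosZ, sum_slackBlock_mul_cosZ,
      hfz i j _ fun c => by rw [mul_neg, cosZ_neg]]
  · refine le_trans (le_of_eq ?_) hle
    rw [reducedObjective_eq hn k y' hf hX]
    congr 1
    · rw [← e.sum_comp, Fintype.sum_prod_type]
      simp only [y', ← Finset.sum_div, mul_div_cancel₀ _ hn0]
    · congr 1
      have h1 : ∀ i j, ∑ c, f i j c = ∑ c, z i j c := fun i j => by
        simpa using hfz i j (fun _ => 1) fun _ => rfl
      have h2 : ∀ i j, ∑ c, z i j c = (∑ a, ∑ b, Z (e (i, a)) (e (j, b))) / n := fun i j => by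
        simp only [z, ← Finset.sum_div]
        rw [Finset.sum_comm]
        congr 1
        exact Finset.sum_congr rfl fun a _ =>
          Equiv.sum_comp (Equiv.addLeft a) fun b => Z (e (i, a)) (e (j, b))
      rw [← e.sum_comp]
      have h3 : ∀ u, ∑ v, Z u v = ∑ q, Z u (e q) := fun u => (e.sum_comp fun v => Z u v).symm
      simp only [h3, h1, h2, Fintype.sum_prod_type, ← Finset.sum_div,
        mul_div_cancel₀ _ hn0]
      exact Finset.sum_congr rfl fun i _ => Finset.sum_comm

end Reduction

end FriezeJerrum

theorem lemma3p2 (n k : ℕ) (hn : Odd n) (hk : 2 ≤ k) :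
    IsGreatest (FriezeJerrum.values k (FriezeJerrum.chordGraph n))
        (FriezeJerrum.bound k (FriezeJerrum.chordGraph n)) ∧
      IsLeast (FriezeJerrum.reducedValues n k)
        (FriezeJerrum.bound k (FriezeJerrum.chordGraph n)) := by
  have : NeZero n := ⟨hn.pos.ne'⟩
  have hG := FriezeJerrum.isGreatest_bound hk (FriezeJerrum.chordGraph n)
  obtain ⟨w, hw, hle⟩ := FriezeJerrum.exists_mem_reducedValues_le_bound hn hk
  have hlow : ∀ w ∈ FriezeJerrum.reducedValues n k,
      FriezeJerrum.bound k (FriezeJerrum.chordGraph n) ≤ w := fun w hw =>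
    FriezeJerrum.values_le_reducedValues hn hG.1 hw
  exact ⟨hG, le_antisymm hle (hlow w hw) ▸ hw, hlow⟩
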